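/- Let $\mathcal X$ be a set and $\mathcal H\subseteq\{0,1\}^{\mathcal X}$ a nonempty hypothesis class of finite Littlestone dimension $\mathrm{Ldim}(\mathcal H)$ (the maximal depth of a complete binary tree, with internal nodes labelled by elements of $\mathcal X$ and left/right edges labelled $0/1$, such that for every root-to-leaf path some $h\in\mathcal H$ takes at each node of the path the label of the edge by which the path leaves that node). Consider the following $T$-round quantum online protocol. At round $t$, 1. the learner provides a randomized hypothesis: it draws $h_t:\mathcal X\to\{0,1\}$ from a discrete probability distribution that it chooses on the basis of its earlier hypotheses and measurement outcomes; 2. the adversary chooses a discrete probability distribution $D_t$ on $\mathcal X\times\{0,1\}$, on the basis of everything that happened in the earlier rounds (and of the learner's strategy, but not of the result of the draw of $h_t$), and reveals the quantum example $|\psi_t\rangle=\sum_{x\in\mathcal X,\,y\in\{0,1\}}\sqrt{D_t(x,y)}\,|x,y\rangle$ in $\ell^2(\mathcal X\times\{0,1\})$; 3. the learner applies to $|\psi_t\rangle$ a quantum measurement $\{M_m\}$ of its choice, with $\sum_m M_m^\dagger M_m=I$, and obtains the outcome $m$ with probability $\|M_m|\psi_t\rangle\|^2$; it incurs, without seeing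 it, the loss $\mathbb P_{(x,y)\sim D_t}[h_t(x)\ne y]$. The agnostic regret is $$\mathcal R^{\mathrm{agnostic}}=\sum_{t=1}^T\mathbb P_{(x,y)\sim D_t}[h_t(x)\neq y]-\inf_{h\in\mathcal H}\sum_{t=1}^T\mathbb P_{(x,y)\sim D_t}[h(x)\neq y].$$ **Theorem.** There is a universal constant $C>0$ such that for all $\mathcal X$, all $\mathcal H$ as above and all $T\ge 2$ there is a quantum online learner with $$\mathbb E\big[\mathcal R^{\mathrm{agnostic}}\big]\le C\sqrt{\mathrm{Ldim}(\mathcal H)\cdot T\log T}$$ against every adversary. The expectation is over the learner's draws and the outcomes of its measurements. -/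

import Mathlib

universe u

namespace QuantumOnline

/-! ### Littlestone dimension -/

/-- A complete binary tree of depth `d` with internal nodes labelled in `X` is given by the label
of the node reached along each path of edge labels (`false` is left, `true` is right); only the
paths of length less than `d` matter. It is shattered by `H` if every root-to-leaf path `ε` is
followed by some `h ∈ H`: the value of `h` at each node of the path is the label of the edge
along which the path leaves that node. -/
def Shatters {X : Type u} (H : Set (X → Bool)) (d : ℕ) (tree : List Bool → X) : Prop :=
  ∀ ε : List Bool, ε.length = d →
    ∃ h ∈ H, ∀ i : Fin ε.length, h (tree (ε.take i)) = ε.get i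

/-- The Littlestone dimension: the maximal depth of a complete binary tree shattered by `H`
(`⊤` if there are shattered trees of arbitrarily large depth). -/
noncomputable def littlestoneDim {X : Type u} (H : Set (X → Bool)) : ℕ∞ :=
  ⨆ (d : ℕ) (_ : ∃ tree : List Bool → X, Shatters H d tree), (d : ℕ∞)

/-! ### Quantum examples and measurements -/

/-- The Hilbert space of examples, with orthonormal basis `|x, y⟩` for `x : X` and `y : Bool`. -/
abbrev ExampleSpace (X : Type u) : Type u := lp (fun _ : X × Bool => ℂ) 2

theorem norm_sqrt_rpow {Z : Type u} (D : PMF Z) (z : Z) :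
    ‖((√(D z).toReal : ℝ) : ℂ)‖ ^ (2 : ENNReal).toReal = (D z).toReal := by
  simp [Real.sq_sqrt]

theorem hasSum_toReal {Z : Type u} (D : PMF Z) : HasSum (fun z => (D z).toReal) 1 := by
  have h := ENNReal.hasSum_toReal (f := fun z => D z) (by simp [D.tsum_coe])
  rwa [← ENNReal.tsum_toReal_eq (fun z => D.apply_ne_top z), D.tsum_coe, ENNReal.toReal_one] at h

/-- The quantum example `∑ √(D(x,y)) |x, y⟩` of a distribution `D` on labelled inputs. -/
noncomputable def quantumExample {X : Type u} (D : PMF (X × Bool)) : ExampleSpace X :=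
  ⟨fun z => ((√(D z).toReal : ℝ) : ℂ), memℓp_gen (by
    simp only [norm_sqrt_rpow]
    exact (hasSum_toReal D).summable)⟩

theorem norm_quantumExample {X : Type u} (D : PMF (X × Bool)) : ‖quantumExample D‖ = 1 := by
  have h := lp.norm_rpow_eq_tsum (p := 2) (by norm_num) (quantumExample D)
  have h' : ∀ z, ‖(quantumExample D : X × Bool → ℂ) z‖ ^ (2 : ENNReal).toReal = (D z).toReal :=
    fun z => norm_sqrt_rpow D z
  simp only [h', (hasSum_toReal D).tsum_eq] at h
  simp only [ENNReal.toReal_ofNat, Real.rpow_ofNat] at h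
  exact (pow_eq_one_iff_of_nonneg (norm_nonneg _) two_ne_zero).1 h

/-- A quantum measurement with outcomes in `Ω`: operators `M m` with `∑ m, (M m)† (M m) = 1`,
the sum being taken in the strong operator topology. -/
structure Measurement (E : Type u) [NormedAddCommGroup E] [InnerProductSpace ℂ E]
    [CompleteSpace E] (Ω : Type u) where
  op : Ω → E →L[ℂ] E
  complete : ∀ ψ : E, HasSum (fun m => ContinuousLinearMap.adjoint (op m) (op m ψ)) ψ

theorem Measurement.hasSum_prob {E : Type u} [NormedAddCommGroup E] [InnerProductSpace ℂ E]
    [CompleteSpace E] {Ω : Type u} (M : Measurement E Ω) (ψ : E) :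
    HasSum (fun m => ‖M.op m ψ‖ ^ 2) (‖ψ‖ ^ 2) := by
  have h := (M.complete ψ).mapL (innerSL ℂ ψ)
  simp only [innerSL_apply_apply, ContinuousLinearMap.adjoint_inner_right,
    inner_self_eq_norm_sq_to_K] at h
  exact_mod_cast h

/-- The law of the outcome when the unit vector `ψ` is measured: outcome `m` has probability
`⟨ψ| (M m)† (M m) |ψ⟩ = ‖M m ψ‖ ^ 2`. -/
noncomputable def Measurement.outcome {E : Type u} [NormedAddCommGroup E]
    [InnerProductSpace ℂ E] [CompleteSpace E] {Ω : Type u} (M : Measurement E Ω) (ψ : E)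
    (hψ : ‖ψ‖ = 1) : PMF Ω :=
  ⟨fun m => ENNReal.ofReal (‖M.op m ψ‖ ^ 2), by
    have h := M.hasSum_prob ψ
    have e := ENNReal.ofReal_tsum_of_nonneg (fun m => sq_nonneg ‖M.op m ψ‖) h.summable
    rw [h.tsum_eq, hψ, one_pow, ENNReal.ofReal_one] at e
    rw [e]
    exact ENNReal.summable.hasSum⟩

/-! ### The online protocol -/

/-- A quantum online learner for boolean hypotheses that measures each example on arrival. Its
behaviour depends on its record, the list (latest round first) of the hypotheses it has provided
and the measurement outcomes it has obtained: `hypothesis` is the law from which the next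
hypothesis is drawn, and `measurement` is the measurement it then applies to the next example. -/
structure Learner (X : Type u) where
  Outcome : Type u
  hypothesis : List ((X → Bool) × Outcome) → PMF (X → Bool)
  measurement : List ((X → Bool) × Outcome) → (X → Bool) →
    Measurement (ExampleSpace X) Outcome

/-- What happens in one round: the hypothesis `h_t` of the learner, the distribution `D_t` of the
adversary, and the outcome of the learner's measurement of the example. -/
structure Round (X Ω : Type u) where
  hyp : X → Bool
  dist : PMF (X × Bool)
  outcome : Ω

/-- The part of a transcript that the learner knows. -/
def record {X Ω : Type u} (r : List (Round X Ω)) : List ((X → Bool) × Ω) :=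
  r.map fun k => (k.hyp, k.outcome)

/-- An adaptive adversary chooses the distribution of the next example, on the basis of the whole
transcript of the earlier rounds (latest round first). -/
abbrev Adversary (X Ω : Type u) : Type u := List (Round X Ω) → PMF (X × Bool)

/-- The law of the transcript (latest round first) of the first `T` rounds. In each round the
learner draws a hypothesis, the adversary chooses `D` without knowing the outcome of that draw,
and the learner measures the quantum example of `D`. -/
noncomputable def play {X : Type u} (L : Learner X) (A : Adversary X L.Outcome) :
    ℕ → PMF (List (Round X L.Outcome))
  | 0 => PMF.pure []
  | T + 1 =>
    (play L A T).bind fun r =>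
      (L.hypothesis (record r)).bind fun h =>
        ((L.measurement (record r) h).outcome (quantumExample (A r))
          (norm_quantumExample (A r))).bind fun m =>
            PMF.pure (⟨h, A r, m⟩ :: r)

/-- The loss `P_{(x,y) ∼ D}[h(x) ≠ y]`. -/
noncomputable def loss {X : Type u} (D : PMF (X × Bool)) (h : X → Bool) : ℝ :=
  (D.toOuterMeasure {z | h z.1 ≠ z.2}).toReal

/-- The agnostic regret
`∑ t, P_{D_t}[h_t(x) ≠ y] - inf_{g ∈ H} ∑ t, P_{D_t}[g(x) ≠ y]` of a transcript. -/
noncomputable def regret {X Ω : Type u} (H : Set (X → Bool)) (r : List (Round X Ω)) : ℝ :=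
  (r.map fun k => loss k.dist k.hyp).sum - ⨅ g : H, (r.map fun k => loss k.dist g).sum

/-- The expectation of a real function of a random variable with law `P`
(meaningful if the sum converges absolutely). -/
noncomputable def expectation {Z : Type u} (P : PMF Z) (f : Z → ℝ) : ℝ :=
  ∑' z, (P z).toReal * f z

end QuantumOnline

/-!
The learner measures every example in the computational basis. The outcome `zₜ = (xₜ, yₜ)` is then
a classical sample from `Dₜ` (`outcome_basisMeasurement`), and it remains to learn from samples,
although the regret compares the true losses under the adaptively chosen `Dₜ`. The regret splits
into two parts of order `√(d T log T)`.

*Competing on the samples.* A hypothesis of the class is tracked on any sequence of `T` inputs by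
one of the `(T + 1) ^ d` experts that run the standard optimal algorithm with at most `d`
predictions flipped, since each flip lowers the depth of the trees shattered by the version space
(`exists_flips`). Exponential weights over these experts give the deterministic bound
`hedgeLoss_le`. Given the past, the draw of `hₜ` is independent of `zₜ`, so in expectation the
errors on the samples are the losses of the learner (`mean_learnerLoss_hedge`).

*From the samples to the losses.* The best hypothesis on the samples is compared with the best
hypothesis for the losses by a uniform law of large numbers for adaptive sequences: the supremum
over the class of `∑ₜ (err zₜ h - loss Dₜ h)` has a bounded exponential moment
(`mean_exp_deviation_le`). Its proof follows the recursively defined `potential`, in which each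
round contributes a random sign times the difference of two adversarially chosen evaluations.
Jensen's inequality and the symmetry between the sample and an independent copy show that one round
of the protocol costs at most one round of the potential (`mean_potential_le_succ`). The potential
itself is bounded by splitting the class along the revealed inputs: the number of parts satisfies
Pascal's recursion in the depth of the shattered trees, and on each part the signed loss of the
round is a constant, so that `cosh x ≤ exp (x ^ 2 / 2)` applies (`potential_le`).

When `d = 0` the class is a single hypothesis, which the learner repeats without regret.
-/

namespace QuantumOnline

open scoped ENNReal

/-! ### Measuring in the computational basis -/

open Classical in
/-- The measurement in the computational basis: the projections onto the lines spanned by the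
basis vectors `|x, y⟩`. -/
noncomputable def basisMeasurement (X : Type u) : Measurement (ExampleSpace X) (X × Bool) where
  op z := InnerProductSpace.rankOne ℂ (lp.single 2 z (1 : ℂ) : ExampleSpace X)
    (lp.single 2 z (1 : ℂ) : ExampleSpace X)
  complete ψ := by
    convert lp.hasSum_single (E := fun _ : X × Bool => ℂ) ENNReal.ofNat_ne_top ψ using 2 with z
    rw [InnerProductSpace.adjoint_rankOne]
    simp only [InnerProductSpace.rankOne_apply, inner_smul_right, lp.inner_single_left,
      lp.single_apply_self]
    rw [← lp.single_smul]
    simp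

/-- Measuring a quantum example in the computational basis yields a classical example. -/
theorem outcome_basisMeasurement {X : Type u} (D : PMF (X × Bool)) :
    (basisMeasurement X).outcome (quantumExample D) (norm_quantumExample D) = D := by
  classical
  refine PMF.ext fun z => ?_
  change ENNReal.ofReal (‖(basisMeasurement X).op z (quantumExample D)‖ ^ 2) = D z
  have h : ‖(basisMeasurement X).op z (quantumExample D)‖ ^ 2 = (D z).toReal := by
    simp only [basisMeasurement, InnerProductSpace.rankOne_apply, lp.inner_single_left, norm_smul,
      lp.norm_single (E := fun _ : X × Bool => ℂ) two_pos]
    simp [quantumExample, Real.sq_sqrt]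
  rw [h, ENNReal.ofReal_toReal (D.apply_ne_top z)]

/-! ### Expectations of nonnegative functions -/

/-- The expectation of a function with values in `[0, ∞]`. -/
noncomputable def mean {Z : Type*} (P : PMF Z) (F : Z → ℝ≥0∞) : ℝ≥0∞ := ∑' z, P z * F z

section mean

variable {Z W : Type*}

theorem mean_pure (a : Z) (F : Z → ℝ≥0∞) : mean (PMF.pure a) F = F a := by
  rw [mean, tsum_eq_single a]
  · simp
  · intro b hb
    simp [PMF.pure_apply, hb]

theorem mean_bind (P : PMF Z) (k : Z → PMF W) (F : W → ℝ≥0∞) :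
    mean (P.bind k) F = mean P fun z => mean (k z) F := by
  simp only [mean, PMF.bind_apply, ← ENNReal.tsum_mul_right, ← ENNReal.tsum_mul_left]
  rw [ENNReal.tsum_comm]
  simp only [mul_assoc]

theorem mean_const (P : PMF Z) (c : ℝ≥0∞) : mean P (fun _ => c) = c := by
  rw [mean, ENNReal.tsum_mul_right, P.tsum_coe, one_mul]

theorem mean_add (P : PMF Z) (F G : Z → ℝ≥0∞) :
    mean P (fun z => F z + G z) = mean P F + mean P G := by
  simp only [mean, mul_add, ENNReal.tsum_add]

theorem mean_mul_left (P : PMF Z) (c : ℝ≥0∞) (F : Z → ℝ≥0∞) :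
    mean P (fun z => c * F z) = c * mean P F := by
  simp only [mean, ← ENNReal.tsum_mul_left, mul_left_comm]

theorem mean_comm (P : PMF Z) (Q : PMF W) (F : Z → W → ℝ≥0∞) :
    mean P (fun z => mean Q (F z)) = mean Q fun w => mean P fun z => F z w := by
  simp only [mean, ← ENNReal.tsum_mul_left]
  rw [ENNReal.tsum_comm]
  simp only [mul_left_comm]

theorem mean_mono_support (P : PMF Z) {F G : Z → ℝ≥0∞} (h : ∀ z ∈ P.support, F z ≤ G z) :
    mean P F ≤ mean P G := by
  refine ENNReal.tsum_le_tsum fun z => ?_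
  by_cases hz : P z = 0
  · simp [hz]
  · gcongr
    exact h z ((P.mem_support_iff z).2 hz)

theorem mean_mono (P : PMF Z) {F G : Z → ℝ≥0∞} (h : ∀ z, F z ≤ G z) : mean P F ≤ mean P G :=
  mean_mono_support P fun z _ => h z

theorem hasSum_of_mean_ofReal (P : PMF Z) {f : Z → ℝ} (hf : ∀ z, 0 ≤ f z)
    (h : mean P (fun z => ENNReal.ofReal (f z)) ≠ ∞) :
    HasSum (fun z => (P z).toReal * f z) (mean P fun z => ENNReal.ofReal (f z)).toReal := by
  have := ENNReal.hasSum_toReal h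
  rw [← ENNReal.tsum_toReal_eq (ENNReal.ne_top_of_tsum_ne_top h)] at this
  simpa [mean, ENNReal.toReal_mul, ENNReal.toReal_ofReal (hf _)] using this

end mean

/-! ### Losses -/

section loss

variable {X : Type u}

/-- The zero-one loss of the hypothesis `h` on the labelled input `z`. -/
def err (z : X × Bool) (h : X → Bool) : ℝ := if h z.1 ≠ z.2 then 1 else 0

theorem err_nonneg (z : X × Bool) (h : X → Bool) : 0 ≤ err z h := by
  unfold err; split <;> norm_num

theorem err_le_one (z : X × Bool) (h : X → Bool) : err z h ≤ 1 := by
  unfold err; split <;> norm_num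

theorem ofReal_err_le_one (z : X × Bool) (h : X → Bool) : ENNReal.ofReal (err z h) ≤ 1 :=
  ENNReal.ofReal_le_one.2 (err_le_one z h)

theorem toOuterMeasure_eq_mean (D : PMF (X × Bool)) (h : X → Bool) :
    D.toOuterMeasure {z | h z.1 ≠ z.2} = mean D fun z => ENNReal.ofReal (err z h) := by
  rw [PMF.toOuterMeasure_apply]
  refine tsum_congr fun z => ?_
  by_cases hz : h z.1 = z.2 <;> simp [err, hz]

theorem mean_err_le_one (D : PMF (X × Bool)) (h : X → Bool) :
    mean D (fun z => ENNReal.ofReal (err z h)) ≤ 1 :=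
  (mean_mono D fun z => ofReal_err_le_one z h).trans_eq (mean_const D 1)

theorem ofReal_loss (D : PMF (X × Bool)) (h : X → Bool) :
    ENNReal.ofReal (loss D h) = mean D fun z => ENNReal.ofReal (err z h) := by
  rw [loss, toOuterMeasure_eq_mean, ENNReal.ofReal_toReal]
  exact ne_top_of_le_ne_top ENNReal.one_ne_top (mean_err_le_one D h)

theorem loss_nonneg (D : PMF (X × Bool)) (h : X → Bool) : 0 ≤ loss D h := ENNReal.toReal_nonneg

theorem loss_le_one (D : PMF (X × Bool)) (h : X → Bool) : loss D h ≤ 1 := by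
  rw [loss, toOuterMeasure_eq_mean]
  exact ENNReal.toReal_le_of_le_ofReal zero_le_one (by simpa using mean_err_le_one D h)

/-- The probability that a hypothesis drawn from `p` errs on the labelled input `z`. -/
noncomputable def errProb (p : PMF (X → Bool)) (z : X × Bool) : ℝ :=
  (mean p fun h => ENNReal.ofReal (err z h)).toReal

theorem errProb_nonneg (p : PMF (X → Bool)) (z : X × Bool) : 0 ≤ errProb p z :=
  ENNReal.toReal_nonneg

theorem ofReal_errProb (p : PMF (X → Bool)) (z : X × Bool) :
    ENNReal.ofReal (errProb p z) = mean p fun h => ENNReal.ofReal (err z h) := by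
  refine ENNReal.ofReal_toReal (ne_top_of_le_ne_top ENNReal.one_ne_top ?_)
  exact (mean_mono p fun h => ofReal_err_le_one z h).trans_eq (mean_const p 1)

end loss

/-! ### Trees and Littlestone dimension -/

section Littlestone

variable {X : Type u} {V W : Set (X → Bool)} {n : ℕ}

/-- The hypotheses in `V` that take the value `b` at `x`. -/
def cut (V : Set (X → Bool)) (x : X) (b : Bool) : Set (X → Bool) := {h ∈ V | h x = b}

/-- The class `V` shatters some complete binary tree of depth `n`. -/
def ShattersDepth (V : Set (X → Bool)) (n : ℕ) : Prop := ∃ tree : List Bool → X, Shatters V n tree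

theorem ShattersDepth.mono (hVW : V ⊆ W) (h : ShattersDepth V n) : ShattersDepth W n := by
  obtain ⟨tree, ht⟩ := h
  refine ⟨tree, fun ε hε => ?_⟩
  obtain ⟨g, hg, hg'⟩ := ht ε hε
  exact ⟨g, hVW hg, hg'⟩

theorem shattersDepth_zero (x : X) (hV : V.Nonempty) : ShattersDepth V 0 := by
  obtain ⟨h, hh⟩ := hV
  refine ⟨fun _ => x, fun ε hε => ⟨h, hh, fun i => ?_⟩⟩
  exact absurd i.2 (by omega)

theorem ShattersDepth.of_succ (h : ShattersDepth V (n + 1)) : ShattersDepth V n := by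
  obtain ⟨tree, ht⟩ := h
  refine ⟨tree, fun ε hε => ?_⟩
  obtain ⟨g, hg, hg'⟩ := ht (ε ++ [true]) (by simp [hε])
  refine ⟨g, hg, fun i => ?_⟩
  have := hg' ⟨i, by have := i.2; rw [List.length_append]; omega⟩
  simpa [List.take_append_of_le_length i.2.le, List.getElem_append_left i.2] using this

theorem ShattersDepth.of_le {m : ℕ} (hmn : m ≤ n) (h : ShattersDepth V n) : ShattersDepth V m := by
  induction n, hmn using Nat.le_induction with
  | base => exact h
  | succ n _ ih => exact ih h.of_succ

/-- Two trees shattered by the two halves of a class can be joined under a new root. -/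
theorem ShattersDepth.join {x : X} (h : ∀ b, ShattersDepth (cut V x b) n) :
    ShattersDepth V (n + 1) := by
  choose tree ht using h
  refine ⟨fun p => p.casesOn x fun b p => tree b p, fun ε hε => ?_⟩
  obtain _ | ⟨b, ε⟩ := ε
  · simp at hε
  obtain ⟨g, hg, hg'⟩ := ht b ε (by simpa using hε)
  refine ⟨g, hg.1, fun i => ?_⟩
  obtain ⟨i, hi⟩ := i
  cases i with
  | zero => simpa using hg.2
  | succ i => simpa using hg' ⟨i, by simpa using hi⟩

/-- Of the two halves of a class, one shatters trees at least as deep as the other does. -/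
theorem exists_deeper_cut (V : Set (X → Bool)) (x : X) :
    ∃ b, ∀ n, ShattersDepth (cut V x !b) n → ShattersDepth (cut V x b) n := by
  by_contra! H
  obtain ⟨m, hm, hm'⟩ := H true
  obtain ⟨n, hn, hn'⟩ := H false
  rcases le_total m n with hmn | hmn
  · exact hm' (ShattersDepth.of_le hmn hn)
  · exact hn' (ShattersDepth.of_le hmn hm)

/-- The prediction at `x` of the standard optimal algorithm with version space `V`: the label
whose half of `V` shatters the deeper trees. -/
noncomputable def soa (V : Set (X → Bool)) (x : X) : Bool := (exists_deeper_cut V x).choose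

/-- A wrong prediction of the standard optimal algorithm makes the depth drop. -/
theorem not_shattersDepth_cut_not_soa (x : X) (h : ¬ ShattersDepth V (n + 1)) :
    ¬ ShattersDepth (cut V x !(soa V x)) n := by
  intro h'
  refine h (ShattersDepth.join (x := x) fun b => ?_)
  by_cases hb : b = soa V x
  · exact hb ▸ (exists_deeper_cut V x).choose_spec n h'
  · rwa [Bool.eq_not_of_ne hb]

theorem not_shattersDepth_of_littlestoneDim_eq {d : ℕ} (h : littlestoneDim V = d) :
    ¬ ShattersDepth V (d + 1) := by
  intro h'
  have : ((d + 1 : ℕ) : ℕ∞) ≤ littlestoneDim V :=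
    le_iSup₂ (f := fun (d : ℕ) (_ : ∃ tree : List Bool → X, Shatters V d tree) => (d : ℕ∞))
      (d + 1) h'
  rw [h, Nat.cast_le] at this
  omega

theorem subsingleton_of_not_shattersDepth_one (h : ¬ ShattersDepth V 1) : V.Subsingleton := by
  intro f hf g hg
  by_contra hfg
  obtain ⟨x, hx⟩ := Function.ne_iff.1 hfg
  refine h (ShattersDepth.join (x := x) fun b => shattersDepth_zero x ?_)
  by_cases hb : f x = b
  · exact ⟨f, hf, hb⟩
  · exact ⟨g, hg, by rw [Bool.eq_not_of_ne hx] at hb; simpa using hb⟩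

end Littlestone

/-! ### Symmetrized exponential moments -/

section potential

variable {X : Type u} {V : Set (X → Bool)} {g : (X → Bool) → ℝ} {l : ℝ}

/-- The symmetrized exponential potential with `k` rounds to go: the largest value of
`𝔼 sup_{h ∈ V} exp (l (g h + ∑ₜ εₜ (err zₜ h - err zₜ' h)))`, with independent random signs `εₜ`
and labelled inputs `zₜ`, `zₜ'` that an opponent chooses knowing the earlier signs. -/
noncomputable def potential (l : ℝ) : ℕ → Set (X → Bool) → ((X → Bool) → ℝ) → ℝ≥0∞
  | 0, V, g => ⨆ h ∈ V, ENNReal.ofReal (Real.exp (l * g h))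
  | k + 1, V, g => ⨆ (z : X × Bool) (z' : X × Bool),
      (potential l k V (fun h => g h + (err z h - err z' h)) +
        potential l k V (fun h => g h + (err z' h - err z h))) / 2

theorem potential_empty (k : ℕ) : potential l k (∅ : Set (X → Bool)) g = 0 := by
  induction k generalizing g with
  | zero => simp [potential]
  | succ k ih => simp [potential, ih]

theorem potential_le_cut_add_cut (k : ℕ) (x : X) (b : Bool) :
    potential l k V g ≤ potential l k (cut V x b) g + potential l k (cut V x !b) g := by
  induction k generalizing g with
  | zero =>
    refine iSup₂_le fun f hf => ?_
    by_cases hb : f x = b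
    · exact le_add_right (le_iSup₂ (f := fun f (_ : f ∈ cut V x b) =>
        ENNReal.ofReal (Real.exp (l * g f))) f ⟨hf, hb⟩)
    · exact le_add_left (le_iSup₂ (f := fun f (_ : f ∈ cut V x !b) =>
        ENNReal.ofReal (Real.exp (l * g f))) f ⟨hf, Bool.eq_not_of_ne hb⟩)
  | succ k ih =>
    refine iSup₂_le fun z z' => ?_
    refine (ENNReal.div_le_div_right (add_le_add ih ih) 2).trans ?_
    rw [add_add_add_comm, ENNReal.add_div]
    exact add_le_add
      (le_iSup₂ (f := fun z z' : X × Bool =>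
        (potential l k (cut V x b) (fun h => g h + (err z h - err z' h)) +
        potential l k (cut V x b) (fun h => g h + (err z' h - err z h))) / 2) z z')
      (le_iSup₂ (f := fun z z' : X × Bool =>
        (potential l k (cut V x !b) (fun h => g h + (err z h - err z' h)) +
        potential l k (cut V x !b) (fun h => g h + (err z' h - err z h))) / 2) z z')

/-- Jensen's inequality for the exponential of an average zero-one loss. -/
theorem ofReal_exp_sub_loss_le (D : PMF (X × Bool)) (h : X → Bool) (c : ℝ) :
    ENNReal.ofReal (Real.exp (l * (c - loss D h))) ≤
      mean D fun z => ENNReal.ofReal (Real.exp (l * (c - err z h))) := by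
  set e := Real.exp (l * (c - loss D h)) with he
  have hs : HasSum (fun z => (D z).toReal * err z h) (loss D h) := by
    have := hasSum_of_mean_ofReal D (fun z => err_nonneg z h)
      (ne_top_of_le_ne_top ENNReal.one_ne_top (mean_err_le_one D h))
    rwa [← ofReal_loss, ENNReal.toReal_ofReal (loss_nonneg D h)] at this
  by_cases htop : mean D (fun z => ENNReal.ofReal (Real.exp (l * (c - err z h)))) = ∞
  · rw [htop]; exact le_top
  have hs' := hasSum_of_mean_ofReal D (fun z => (Real.exp_pos (l * (c - err z h))).le) htop
  rw [← ENNReal.ofReal_toReal htop]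
  refine ENNReal.ofReal_le_ofReal ?_
  -- the tangent line of `exp` at the average
  have ht := ((hasSum_toReal D).mul_left (e * (1 + l * loss D h))).sub (hs.mul_left (e * l))
  have := hasSum_le (fun z => ?_) ht hs'
  · linarith
  · have h1 : e * (1 + (l * (c - err z h) - l * (c - loss D h))) ≤
        Real.exp (l * (c - err z h)) := by
      have h2 := Real.add_one_le_exp (l * (c - err z h) - l * (c - loss D h))
      calc _ ≤ e * Real.exp (l * (c - err z h) - l * (c - loss D h)) := by
            gcongr; linarith
        _ = _ := by rw [he, ← Real.exp_add]; ring_nf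
    have h3 := mul_le_mul_of_nonneg_left h1 (ENNReal.toReal_nonneg (a := D z))
    linarith

/-- The potential is convex in `g`, so it can only grow when a sample replaces an average. -/
theorem potential_sub_loss_le (k : ℕ) (D : PMF (X × Bool)) :
    potential l k V (fun h => g h - loss D h) ≤
      mean D fun z => potential l k V fun h => g h - err z h := by
  induction k generalizing g with
  | zero =>
    refine iSup₂_le fun h hh => (ofReal_exp_sub_loss_le D h (g h)).trans ?_
    exact mean_mono D fun z => le_iSup₂ (f := fun h (_ : h ∈ V) =>
      ENNReal.ofReal (Real.exp (l * (g h - err z h)))) h hh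
  | succ k ih =>
    refine iSup₂_le fun a b => ?_
    have e : ∀ a b : X × Bool,
        potential l k V (fun h => g h - loss D h + (err a h - err b h)) ≤
        mean D fun z => potential l k V fun h => g h - err z h + (err a h - err b h) := by
      intro a b
      have := ih (g := fun h => g h + (err a h - err b h))
      simpa only [sub_add_eq_add_sub] using this
    refine (ENNReal.div_le_div_right (add_le_add (e a b) (e b a)) 2).trans ?_
    rw [← mean_add, div_eq_mul_inv, mul_comm, ← mean_mul_left]
    refine mean_mono D fun z => ?_
    rw [mul_comm, ← div_eq_mul_inv]
    exact le_iSup₂ (f := fun a b : X × Bool =>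
        (potential l k V (fun h => g h - err z h + (err a h - err b h)) +
        potential l k V (fun h => g h - err z h + (err b h - err a h))) / 2) a b

/-- Symmetrization: a deviation of a sample from its mean costs one round of the potential. -/
theorem mean_potential_le_succ (k : ℕ) (D : PMF (X × Bool)) :
    (mean D fun z => potential l k V fun h => g h + (err z h - loss D h)) ≤
      potential l (k + 1) V g := by
  set F : X × Bool → X × Bool → ℝ≥0∞ := fun z z' =>
    potential l k V fun h => g h + (err z h - err z' h) with hF
  have h1 : (mean D fun z => potential l k V fun h => g h + (err z h - loss D h)) ≤
      mean D fun z => mean D (F z) := by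
    refine mean_mono D fun z => ?_
    have := potential_sub_loss_le (l := l) (V := V) (g := fun h => g h + err z h) k D
    simpa only [hF, add_sub_assoc] using this
  have h2 : (mean D fun z => mean D (F z)) = mean D fun z => mean D fun z' =>
      (2 : ℝ≥0∞)⁻¹ * (F z z' + F z' z) := by
    simp only [mean_mul_left, mean_add]
    rw [mean_comm D D fun z z' => F z' z, ← two_mul, ← mul_assoc,
      ENNReal.inv_mul_cancel two_ne_zero ENNReal.ofNat_ne_top, one_mul]
  rw [h2] at h1
  refine h1.trans ?_
  refine (mean_mono D fun z => mean_mono D fun z' => ?_).trans_eq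
    ((mean_const D _).trans (mean_const D (potential l (k + 1) V g)))
  rw [mul_comm, ← div_eq_mul_inv]
  exact le_iSup₂ (f := fun z z' => (F z z' + F z' z) / 2) z z'

/-- A bound for the number of labellings of `m` inputs, revealed one at a time, by a class that
shatters no tree of depth `n`. -/
def growth : ℕ → ℕ → ℕ
  | _, 0 => 0
  | 0, _ + 1 => 1
  | m + 1, n + 1 => growth m (n + 1) + growth m n

theorem growth_le (m n : ℕ) : growth m (n + 1) ≤ (m + 1) ^ n := by
  induction m generalizing n with
  | zero => simp [growth]
  | succ m ih =>
    cases n with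
    | zero => simpa [growth] using ih 0
    | succ n =>
      rw [growth]
      calc _ ≤ (m + 1) ^ (n + 1) + (m + 1) ^ n := add_le_add (ih _) (ih _)
        _ = (m + 2) * (m + 1) ^ n := by ring
        _ ≤ (m + 2) * (m + 2) ^ n := by gcongr; omega
        _ = _ := by ring

/-- A subadditive function of a class that is at most `growth m n * c` on the two halves of `V` is
at most `growth (m + 1) n * c` on `V`. -/
theorem le_growth_succ_mul {Φ : Set (X → Bool) → ℝ≥0∞} (h0 : Φ ∅ = 0)
    (hΦ : ∀ V x b, Φ V ≤ Φ (cut V x b) + Φ (cut V x !b)) {n m : ℕ} {c : ℝ≥0∞} (x : X)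
    (h : ∀ (b : Bool) (n : ℕ), ¬ ShattersDepth (cut V x b) n → Φ (cut V x b) ≤ growth m n * c)
    (hV : ¬ ShattersDepth V n) : Φ V ≤ growth (m + 1) n * c := by
  cases n with
  | zero =>
    have : V = ∅ := by
      by_contra hne
      exact hV (shattersDepth_zero x (Set.nonempty_iff_ne_empty.2 hne))
    rw [this, h0]
    exact zero_le
  | succ n =>
    refine (hΦ V x (soa V x)).trans ?_
    rw [growth, Nat.cast_add, add_mul]
    refine add_le_add (h _ _ fun h' => hV (h'.mono fun f hf => hf.1)) (h _ _ ?_)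
    exact not_shattersDepth_cut_not_soa x hV

theorem ofReal_exp_add_ofReal_exp_div_two_le {δ c : ℝ} (hδ : |δ| ≤ 1) :
    (ENNReal.ofReal (Real.exp (l * (c + δ))) + ENNReal.ofReal (Real.exp (l * (c - δ)))) / 2 ≤
      ENNReal.ofReal (Real.exp (l ^ 2 / 2)) * ENNReal.ofReal (Real.exp (l * c)) := by
  rw [← ENNReal.ofReal_add (Real.exp_pos _).le (Real.exp_pos _).le,
    ← ENNReal.ofReal_mul (Real.exp_pos _).le, show (2 : ℝ≥0∞) = ENNReal.ofReal 2 by simp,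
    ← ENNReal.ofReal_div_of_pos two_pos]
  refine ENNReal.ofReal_le_ofReal ?_
  have h1 : (Real.exp (l * (c + δ)) + Real.exp (l * (c - δ))) / 2 =
      Real.cosh (l * δ) * Real.exp (l * c) := by
    rw [Real.cosh_eq, mul_add, mul_sub, Real.exp_add, sub_eq_add_neg, Real.exp_add]
    ring
  rw [h1]
  gcongr
  refine (Real.cosh_le_exp_half_sq _).trans (Real.exp_le_exp.2 ?_)
  have : δ ^ 2 ≤ 1 := (sq_le_one_iff_abs_le_one δ).2 hδ
  nlinarith [sq_nonneg l]

/-- The potential of a class that shatters no tree of depth `n`: the inputs of the `k` rounds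
split the class into few parts on which all signed losses are constant, and each part contributes
the exponential moment of a bounded martingale. -/
theorem potential_le (k : ℕ) {n : ℕ} {c : ℝ} (hV : ¬ ShattersDepth V n) (hg : ∀ h ∈ V, g h = c)
    (x₀ : X) :
    potential l k V g ≤ growth (2 * k) n *
      (ENNReal.ofReal (Real.exp (l ^ 2 / 2)) ^ k * ENNReal.ofReal (Real.exp (l * c))) := by
  induction k generalizing V g n c with
  | zero =>
    cases n with
    | zero =>
      have : V = ∅ := by
        by_contra hne
        exact hV (shattersDepth_zero x₀ (Set.nonempty_iff_ne_empty.2 hne))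
      rw [this, potential_empty]
      exact zero_le
    | succ n =>
      refine iSup₂_le fun h hh => ?_
      simp [growth, hg h hh]
  | succ k ih =>
    refine iSup₂_le fun z z' => ?_
    set E := ENNReal.ofReal (Real.exp (l ^ 2 / 2)) with hE
    set Φ : Set (X → Bool) → ℝ≥0∞ := fun W =>
      (potential l k W (fun h => g h + (err z h - err z' h)) +
        potential l k W (fun h => g h + (err z' h - err z h))) / 2 with hΦ
    have h0 : Φ ∅ = 0 := by simp [hΦ, potential_empty]
    have hadd : ∀ W x b, Φ W ≤ Φ (cut W x b) + Φ (cut W x !b) := by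
      intro W x b
      rw [hΦ, ← ENNReal.add_div, add_add_add_comm]
      exact ENNReal.div_le_div_right
        (add_le_add (potential_le_cut_add_cut k x b) (potential_le_cut_add_cut k x b)) 2
    refine le_growth_succ_mul (m := 2 * k + 1) h0 hadd z.1 (fun b n hb => ?_) hV
    refine le_growth_succ_mul h0 hadd z'.1 (fun b' n hb' => ?_) hb
    -- with the values at both inputs fixed, the signed loss is a constant `δ`
    set δ : ℝ := (if b ≠ z.2 then 1 else 0) - (if b' ≠ z'.2 then 1 else 0) with hδ
    have hδ1 : |δ| ≤ 1 := by
      rw [hδ, abs_le]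
      split_ifs <;> norm_num
    have herr : ∀ h ∈ cut (cut V z.1 b) z'.1 b', g h = c ∧ err z h - err z' h = δ := by
      rintro h ⟨⟨h1, h2⟩, h3⟩
      exact ⟨hg h h1, by rw [err, err, h2, h3]⟩
    have e1 := ih (g := fun h => g h + (err z h - err z' h)) (c := c + δ) hb'
      fun h hh => by rw [(herr h hh).1, (herr h hh).2]
    have e2 := ih (g := fun h => g h + (err z' h - err z h)) (c := c - δ) hb'
      fun h hh => by rw [← neg_sub (err z h), (herr h hh).1, (herr h hh).2, sub_eq_add_neg]
    refine (ENNReal.div_le_div_right (add_le_add e1 e2) 2).trans ?_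
    rw [← mul_add, ← mul_add, mul_div_assoc, mul_div_assoc, pow_succ, mul_assoc]
    gcongr
    exact ofReal_exp_add_ofReal_exp_div_two_le hδ1

end potential

/-! ### Experts -/

section experts

variable {X : Type u} {H : Set (X → Bool)}

/-- The version space, after the examples `zs` (latest first), of the expert that follows the
standard optimal algorithm except in the rounds `t` with `φ t = true`, where it predicts the
opposite, and that takes its own predictions for the true labels. -/
noncomputable def versionSpace (H : Set (X → Bool)) (φ : ℕ → Bool) :
    List (X × Bool) → Set (X → Bool)
  | [] => H
  | z :: zs => cut (versionSpace H φ zs) z.1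
      (Bool.xor (soa (versionSpace H φ zs) z.1) (φ zs.length))

/-- The hypothesis that the expert with flips `φ` recommends after the examples `zs`. -/
noncomputable def advice (H : Set (X → Bool)) (φ : ℕ → Bool) (zs : List (X × Bool)) (x : X) :
    Bool :=
  Bool.xor (soa (versionSpace H φ zs) x) (φ zs.length)

theorem versionSpace_congr {φ φ' : ℕ → Bool} (zs : List (X × Bool))
    (h : ∀ t < zs.length, φ t = φ' t) : versionSpace H φ zs = versionSpace H φ' zs := by
  induction zs with
  | nil => rfl
  | cons z zs ih =>
    rw [versionSpace, versionSpace, ih fun t ht => h t (by simp; omega), h _ (by simp)]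

/-- Every hypothesis is tracked by an expert that flips at most `d` predictions: each flip lowers
the depth of the trees that the version space shatters. -/
theorem exists_flips {d : ℕ} (hH : ¬ ShattersDepth H (d + 1)) {h : X → Bool} (hh : h ∈ H)
    (zs : List (X × Bool)) :
    ∃ I : Finset ℕ, (∀ t ∈ I, t < zs.length) ∧ ∃ n, I.card + n = d ∧
      ¬ ShattersDepth (versionSpace H (fun t => decide (t ∈ I)) zs) (n + 1) ∧
      h ∈ versionSpace H (fun t => decide (t ∈ I)) zs := by
  induction zs with
  | nil => exact ⟨∅, by simp, d, by simp, hH, hh⟩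
  | cons z zs ih =>
    obtain ⟨I, hI, n, hn, hV, hhV⟩ := ih
    have hnot : zs.length ∉ I := fun hmem => (hI _ hmem).false
    set V := versionSpace H (fun t => decide (t ∈ I)) zs with hVdef
    by_cases hz : h z.1 = soa V z.1
    · refine ⟨I, fun t ht => (hI t ht).trans (by simp), n, hn, fun h' => hV (h'.mono ?_), ?_⟩
      · exact fun f hf => hf.1
      · exact ⟨hhV, by simp [← hVdef, hnot, hz]⟩
    · have hcong : versionSpace H (fun t => decide (t ∈ insert zs.length I)) zs = V :=
        versionSpace_congr zs fun t ht => by simp [ht.ne]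
      have hmem : h ∈ cut V z.1 !(soa V z.1) := ⟨hhV, Bool.eq_not_of_ne hz⟩
      have hcut := not_shattersDepth_cut_not_soa z.1 hV
      have hstep : versionSpace H (fun t => decide (t ∈ insert zs.length I)) (z :: zs) =
          cut V z.1 !(soa V z.1) := by
        rw [versionSpace, hcong]
        simp
      obtain _ | n := n
      · exact absurd (shattersDepth_zero z.1 ⟨h, hmem⟩) hcut
      · refine ⟨insert zs.length I, fun t ht => ?_, n, ?_, hstep ▸ hcut, hstep ▸ hmem⟩
        · rcases Finset.mem_insert.1 ht with rfl | ht
          · simp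
          · exact (hI t ht).trans (by simp)
        · rw [Finset.card_insert_of_notMem hnot]
          omega

/-- The flips in the rounds listed by `s`; the value `T` stands for no round. -/
def flips {d T : ℕ} (s : Fin d → Fin (T + 1)) (t : ℕ) : Bool := decide (∃ i, (s i : ℕ) = t)

theorem exists_flips_eq {d T : ℕ} {I : Finset ℕ} (hI : I.card ≤ d) (hT : ∀ t ∈ I, t < T) :
    ∃ s : Fin d → Fin (T + 1), ∀ t < T, flips s t = decide (t ∈ I) := by
  have hlt : ∀ i : ℕ, I.toList.getD i T < T + 1 := by
    intro i
    by_cases hi : i < I.toList.length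
    · rw [List.getD_eq_getElem _ _ hi]
      exact (hT _ (Finset.mem_toList.1 (List.getElem_mem hi))).trans (Nat.lt_succ_self T)
    · rw [List.getD_eq_default _ _ (not_lt.1 hi)]
      exact Nat.lt_succ_self T
  refine ⟨fun i => ⟨I.toList.getD i T, hlt i⟩, fun t ht => decide_eq_decide.2 ⟨?_, ?_⟩⟩
  · rintro ⟨i, hi⟩
    by_cases hlen : (i : ℕ) < I.toList.length
    · rw [← Finset.mem_toList, ← hi]
      simp only [List.getD_eq_getElem _ _ hlen]
      exact List.getElem_mem hlen
    · simp only [List.getD_eq_default _ _ (not_lt.1 hlen)] at hi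
      omega
  · intro hmem
    obtain ⟨i, hi, hi'⟩ := List.getElem_of_mem (Finset.mem_toList.2 hmem)
    refine ⟨⟨i, (by simpa using hi : i < I.card).trans_le hI⟩, ?_⟩
    simp only [List.getD_eq_getElem _ _ hi, hi']

/-- The number of errors of the expert with flips `φ` on the examples `zs`. -/
noncomputable def expertLoss (H : Set (X → Bool)) (φ : ℕ → Bool) : List (X × Bool) → ℝ
  | [] => 0
  | z :: zs => expertLoss H φ zs + err z (advice H φ zs)

theorem expertLoss_eq_of_mem {φ : ℕ → Bool} {h : X → Bool} {zs : List (X × Bool)}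
    (hh : h ∈ versionSpace H φ zs) : expertLoss H φ zs = (zs.map fun z => err z h).sum := by
  induction zs with
  | nil => rfl
  | cons z zs ih =>
    rw [expertLoss, ih hh.1, List.map_cons, List.sum_cons, add_comm]
    have : h z.1 = advice H φ zs z.1 := hh.2
    rw [err, err, this]

theorem exists_expertLoss_eq {d T : ℕ} (hH : ¬ ShattersDepth H (d + 1)) {h : X → Bool}
    (hh : h ∈ H) {zs : List (X × Bool)} (hzs : zs.length = T) :
    ∃ s : Fin d → Fin (T + 1), expertLoss H (flips s) zs = (zs.map fun z => err z h).sum := by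
  obtain ⟨I, hI, n, hn, -, hmem⟩ := exists_flips hH hh zs
  obtain ⟨s, hs⟩ := exists_flips_eq (show I.card ≤ d by omega) fun t ht => hzs ▸ hI t ht
  refine ⟨s, expertLoss_eq_of_mem ?_⟩
  rwa [versionSpace_congr zs fun t ht => hs t (hzs ▸ ht)]

end experts

/-! ### Exponential weights -/

section hedge

variable {X : Type u} (H : Set (X → Bool)) (d T : ℕ) (l : ℝ)

/-- The total weight of the experts with learning rate `l` after the examples `zs`. -/
noncomputable def weight (zs : List (X × Bool)) : ℝ :=
  ∑ s : Fin d → Fin (T + 1), Real.exp (-(l * expertLoss H (flips s) zs))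

theorem weight_pos (zs : List (X × Bool)) : 0 < weight H d T l zs :=
  Finset.sum_pos (fun _ _ => Real.exp_pos _) Finset.univ_nonempty

/-- The law of the expert that exponential weights follow after the examples `zs`. -/
noncomputable def expertLaw (zs : List (X × Bool)) : PMF (Fin d → Fin (T + 1)) :=
  PMF.ofFintype
    (fun s => ENNReal.ofReal (Real.exp (-(l * expertLoss H (flips s) zs)) / weight H d T l zs)) (by
    rw [← ENNReal.ofReal_sum_of_nonneg fun s _ =>
      div_nonneg (Real.exp_pos _).le (weight_pos H d T l zs).le, ← Finset.sum_div]
    rw [show ∑ s, _ = weight H d T l zs from rfl, div_self (weight_pos H d T l zs).ne',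
      ENNReal.ofReal_one])

/-- The law of the next hypothesis of the exponential weights algorithm over all experts. -/
noncomputable def hedge (zs : List (X × Bool)) : PMF (X → Bool) :=
  (expertLaw H d T l zs).bind fun s => PMF.pure (advice H (flips s) zs)

theorem errProb_hedge (zs : List (X × Bool)) (z : X × Bool) :
    errProb (hedge H d T l zs) z = (∑ s : Fin d → Fin (T + 1),
      Real.exp (-(l * expertLoss H (flips s) zs)) * err z (advice H (flips s) zs)) /
        weight H d T l zs := by
  have h : (mean (hedge H d T l zs) fun h => ENNReal.ofReal (err z h)) = ENNReal.ofReal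
      ((∑ s : Fin d → Fin (T + 1), Real.exp (-(l * expertLoss H (flips s) zs)) *
        err z (advice H (flips s) zs)) / weight H d T l zs) := by
    simp only [hedge, mean_bind, mean_pure]
    rw [mean, tsum_fintype, Finset.sum_div, ENNReal.ofReal_sum_of_nonneg]
    · refine Finset.sum_congr rfl fun s _ => ?_
      rw [expertLaw, PMF.ofFintype_apply, ← ENNReal.ofReal_mul, div_mul_eq_mul_div]
      exact div_nonneg (Real.exp_pos _).le (weight_pos H d T l zs).le
    · exact fun s _ => div_nonneg (mul_nonneg (Real.exp_pos _).le (err_nonneg _ _))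
        (weight_pos H d T l zs).le
  rw [errProb, h, ENNReal.toReal_ofReal]
  exact div_nonneg (Finset.sum_nonneg fun s _ => mul_nonneg (Real.exp_pos _).le (err_nonneg _ _))
    (weight_pos H d T l zs).le

theorem exp_neg_le {l : ℝ} (hl : 0 ≤ l) : Real.exp (-l) ≤ 1 - l + l ^ 2 / 2 := by
  have h1 := Real.quadratic_le_exp_of_nonneg hl
  have h2 : 0 ≤ 1 - l + l ^ 2 / 2 := by nlinarith [sq_nonneg (l - 1)]
  have h3 := mul_le_mul_of_nonneg_left h1 h2
  rw [Real.exp_neg, inv_le_iff_one_le_mul₀ (Real.exp_pos l)]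
  nlinarith [sq_nonneg (l ^ 2)]

variable {H d T l}

theorem weight_cons_le (hl : 0 ≤ l) (zs : List (X × Bool)) (z : X × Bool) :
    weight H d T l (z :: zs) ≤
      weight H d T l zs * Real.exp (l ^ 2 / 2 - l * errProb (hedge H d T l zs) z) := by
  set q := errProb (hedge H d T l zs) z with hq
  have hW := weight_pos H d T l zs
  have hqW : ∑ s : Fin d → Fin (T + 1), Real.exp (-(l * expertLoss H (flips s) zs)) *
      err z (advice H (flips s) zs) = q * weight H d T l zs := by
    rw [hq, errProb_hedge, div_mul_cancel₀ _ hW.ne']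
  calc weight H d T l (z :: zs)
      ≤ ∑ s : Fin d → Fin (T + 1), (Real.exp (-(l * expertLoss H (flips s) zs)) * (1 + l ^ 2 / 2) -
          l * (Real.exp (-(l * expertLoss H (flips s) zs)) * err z (advice H (flips s) zs))) := by
        refine Finset.sum_le_sum fun s _ => ?_
        rw [expertLoss, mul_add, neg_add, Real.exp_add]
        have h1 : Real.exp (-(l * err z (advice H (flips s) zs))) ≤
            1 + l ^ 2 / 2 - l * err z (advice H (flips s) zs) := by
          unfold err
          split_ifs
          · have := exp_neg_le hl
            rw [mul_one]
            linarith
          · have := sq_nonneg l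
            rw [mul_zero, neg_zero, Real.exp_zero]
            linarith
        have h2 := mul_le_mul_of_nonneg_left h1
          (Real.exp_pos (-(l * expertLoss H (flips s) zs))).le
        linarith
    _ = weight H d T l zs * (l ^ 2 / 2 - l * q + 1) := by
        rw [Finset.sum_sub_distrib, ← Finset.sum_mul, ← Finset.mul_sum, hqW, weight]
        ring
    _ ≤ _ := by
        gcongr
        exact Real.add_one_le_exp _

/-- The expected number of errors of exponential weights on the examples `zs`. -/
noncomputable def hedgeLoss (H : Set (X → Bool)) (d T : ℕ) (l : ℝ) : List (X × Bool) → ℝ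
  | [] => 0
  | z :: zs => hedgeLoss H d T l zs + errProb (hedge H d T l zs) z

theorem hedgeLoss_nonneg (zs : List (X × Bool)) : 0 ≤ hedgeLoss H d T l zs := by
  induction zs with
  | nil => exact le_rfl
  | cons z zs ih => exact add_nonneg ih (errProb_nonneg _ _)

theorem weight_le (hl : 0 ≤ l) (zs : List (X × Bool)) :
    weight H d T l zs ≤ ((T : ℝ) + 1) ^ d *
      Real.exp (l ^ 2 / 2 * zs.length - l * hedgeLoss H d T l zs) := by
  induction zs with
  | nil => simp [weight, expertLoss, hedgeLoss]
  | cons z zs ih =>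
    refine (weight_cons_le hl zs z).trans ?_
    refine (mul_le_mul_of_nonneg_right ih (Real.exp_pos _).le).trans_eq ?_
    rw [mul_assoc, ← Real.exp_add, hedgeLoss, List.length_cons]
    push_cast
    ring_nf

/-- Exponential weights perform almost as well as the best hypothesis in the class. -/
theorem hedgeLoss_le (hl : 0 < l) (hH : ¬ ShattersDepth H (d + 1)) {h : X → Bool} (hh : h ∈ H)
    {zs : List (X × Bool)} (hzs : zs.length = T) :
    hedgeLoss H d T l zs ≤
      (zs.map fun z => err z h).sum + (d * Real.log (T + 1) / l + l * T / 2) := by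
  obtain ⟨s, hs⟩ := exists_expertLoss_eq hH hh hzs
  have h1 : Real.exp (-(l * expertLoss H (flips s) zs)) ≤ weight H d T l zs :=
    Finset.single_le_sum (f := fun s : Fin d → Fin (T + 1) =>
      Real.exp (-(l * expertLoss H (flips s) zs))) (fun _ _ => (Real.exp_pos _).le)
      (Finset.mem_univ s)
  have hT : (0 : ℝ) < (T : ℝ) + 1 := by positivity
  have h2 := Real.log_le_log (Real.exp_pos _) (h1.trans (weight_le hl.le zs))
  rw [Real.log_exp, Real.log_mul (by positivity) (Real.exp_pos _).ne', Real.log_pow, Real.log_exp,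
    hs, hzs] at h2
  have h3 : l * hedgeLoss H d T l zs ≤
      l * ((zs.map fun z => err z h).sum + (d * Real.log (T + 1) / l + l * T / 2)) := by
    have : l * (d * Real.log (T + 1) / l) = d * Real.log (T + 1) := by field_simp
    rw [mul_add, mul_add, this]
    linarith
  exact le_of_mul_le_mul_left h3 hl

end hedge

/-! ### The protocol with measurements in the computational basis -/

section game

variable {X : Type u} {H : Set (X → Bool)}

/-- The learner that measures every example in the computational basis and draws its hypotheses
from the law `p zs`, where `zs` are the labelled inputs observed so far (latest first). -/
noncomputable def measuringLearner (p : List (X × Bool) → PMF (X → Bool)) : Learner X where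
  Outcome := X × Bool
  hypothesis r := p (r.map Prod.snd)
  measurement _ _ := basisMeasurement X

/-- The labelled inputs observed in a transcript. -/
def examples (r : List (Round X (X × Bool))) : List (X × Bool) := r.map Round.outcome

/-- The total loss of the learner in a transcript. -/
noncomputable def learnerLoss (r : List (Round X (X × Bool))) : ℝ :=
  (r.map fun k => loss k.dist k.hyp).sum

/-- The total loss in a transcript of a fixed hypothesis. -/
noncomputable def totalLoss (r : List (Round X (X × Bool))) (h : X → Bool) : ℝ :=
  (r.map fun k => loss k.dist h).sum

/-- The number of errors of a fixed hypothesis on the observed examples, minus its total loss. -/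
noncomputable def deviation (r : List (Round X (X × Bool))) (h : X → Bool) : ℝ :=
  (r.map fun k => err k.outcome h - loss k.dist h).sum

theorem totalLoss_nonneg (r : List (Round X (X × Bool))) (h : X → Bool) : 0 ≤ totalLoss r h := by
  refine List.sum_nonneg fun a ha => ?_
  obtain ⟨k, -, rfl⟩ := List.mem_map.1 ha
  exact loss_nonneg _ _

theorem learnerLoss_nonneg (r : List (Round X (X × Bool))) : 0 ≤ learnerLoss r := by
  refine List.sum_nonneg fun a ha => ?_
  obtain ⟨k, -, rfl⟩ := List.mem_map.1 ha
  exact loss_nonneg _ _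

theorem totalLoss_le_length (r : List (Round X (X × Bool))) (h : X → Bool) :
    totalLoss r h ≤ r.length := by
  refine (List.sum_le_card_nsmul _ 1 fun a ha => ?_).trans (by simp)
  obtain ⟨k, -, rfl⟩ := List.mem_map.1 ha
  exact loss_le_one _ _

theorem learnerLoss_le_length (r : List (Round X (X × Bool))) : learnerLoss r ≤ r.length := by
  refine (List.sum_le_card_nsmul _ 1 fun a ha => ?_).trans (by simp)
  obtain ⟨k, -, rfl⟩ := List.mem_map.1 ha
  exact loss_le_one _ _

theorem sum_err_examples (r : List (Round X (X × Bool))) (h : X → Bool) :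
    ((examples r).map fun z => err z h).sum = totalLoss r h + deviation r h := by
  induction r with
  | nil => simp [examples, totalLoss, deviation]
  | cons k r ih =>
    simp only [examples, totalLoss, deviation, List.map_cons, List.sum_cons] at ih ⊢
    rw [ih]
    ring

variable (p : List (X × Bool) → PMF (X → Bool)) (A : Adversary X (X × Bool)) (T : ℕ)

/-- The law of the transcript against `measuringLearner p`. -/
noncomputable abbrev transcript : PMF (List (Round X (X × Bool))) := play (measuringLearner p) A T

theorem transcript_succ :
    transcript p A (T + 1) = (transcript p A T).bind fun r => (p (examples r)).bind fun h =>
      (A r).bind fun z => PMF.pure (⟨h, A r, z⟩ :: r) := by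
  have hr : ∀ r : List (Round X (X × Bool)), (record r).map Prod.snd = examples r :=
    fun r => List.map_map
  change (transcript p A T).bind (fun r =>
    (p ((record (Ω := X × Bool) r).map Prod.snd)).bind fun h =>
      ((basisMeasurement X).outcome (quantumExample (A r)) (norm_quantumExample (A r))).bind
        fun z => PMF.pure (⟨h, A r, z⟩ :: r)) = _
  simp only [outcome_basisMeasurement, hr]

theorem mean_transcript_zero (F : List (Round X (X × Bool)) → ℝ≥0∞) :
    mean (transcript p A 0) F = F [] :=
  mean_pure _ _

theorem mean_transcript_succ (F : List (Round X (X × Bool)) → ℝ≥0∞) :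
    mean (transcript p A (T + 1)) F = mean (transcript p A T) fun r =>
      mean (p (examples r)) fun h => mean (A r) fun z => F (⟨h, A r, z⟩ :: r) := by
  simp only [transcript_succ, mean_bind, mean_pure]

theorem length_of_mem_support {r : List (Round X (X × Bool))}
    (hr : r ∈ (transcript p A T).support) : r.length = T := by
  induction T generalizing r with
  | zero =>
    have : r ∈ (PMF.pure ([] : List (Round X (X × Bool)))).support := hr
    rw [PMF.mem_support_pure_iff] at this
    simp [this]
  | succ T ih =>
    rw [transcript_succ] at hr
    simp only [PMF.mem_support_bind_iff, PMF.mem_support_pure_iff] at hr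
    obtain ⟨r', hr', h, -, z, -, rfl⟩ := hr
    simp [ih hr']

/-- The draw of the hypothesis and the outcome of the measurement are independent given the past,
so in expectation the learner does not lose more than it errs on the observed examples. -/
theorem mean_learnerLoss_hedge (d n : ℕ) (l : ℝ) :
    (mean (transcript (hedge H d n l) A T) fun r => ENNReal.ofReal (learnerLoss r)) =
      mean (transcript (hedge H d n l) A T) fun r =>
        ENNReal.ofReal (hedgeLoss H d n l (examples r)) := by
  induction T with
  | zero => simp [mean_transcript_zero, learnerLoss, hedgeLoss, examples]
  | succ T ih =>
    rw [mean_transcript_succ, mean_transcript_succ]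
    have h1 : ∀ (r : List (Round X (X × Bool))) h z,
        ENNReal.ofReal (learnerLoss (⟨h, A r, z⟩ :: r)) =
          ENNReal.ofReal (learnerLoss r) + ENNReal.ofReal (loss (A r) h) := by
      intro r h z
      rw [← ENNReal.ofReal_add (learnerLoss_nonneg r) (loss_nonneg _ _), add_comm]
      rfl
    have h2 : ∀ (r : List (Round X (X × Bool))) h z,
        ENNReal.ofReal (hedgeLoss H d n l (examples (⟨h, A r, z⟩ :: r))) =
          ENNReal.ofReal (hedgeLoss H d n l (examples r)) +
            ENNReal.ofReal (errProb (hedge H d n l (examples r)) z) := by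
      intro r h z
      rw [← ENNReal.ofReal_add (hedgeLoss_nonneg _) (errProb_nonneg _ _)]
      rfl
    simp only [h1, h2, mean_add, mean_const, ih, ofReal_loss, ofReal_errProb]
    congr 2
    funext r
    rw [mean_comm]

/-- The potential of the deviations is a supermartingale. -/
theorem mean_potential_deviation_le (l : ℝ) (k : ℕ) :
    (mean (transcript p A T) fun r => potential l k H (deviation r)) ≤
      potential l (k + T) H fun _ => 0 := by
  induction T generalizing k with
  | zero =>
    rw [mean_transcript_zero]
    exact le_of_eq rfl
  | succ T ih =>
    rw [mean_transcript_succ, ← add_assoc, add_right_comm]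
    refine le_trans (mean_mono _ fun r => ?_) (ih (k + 1))
    refine le_trans (mean_mono _ fun h => ?_) (mean_const _ _).le
    refine le_trans (le_of_eq ?_) (mean_potential_le_succ k (A r))
    refine tsum_congr fun z => ?_
    exact congrArg (A r z * potential l k H ·) (funext fun f => add_comm _ _)

variable {T}

/-- The uniform law of large numbers: an exponential moment of the largest deviation. -/
theorem mean_exp_deviation_le {d : ℕ} (l : ℝ) (hH : ¬ ShattersDepth H (d + 1)) (x₀ : X) :
    (mean (transcript p A T) fun r => ⨆ h ∈ H, ENNReal.ofReal (Real.exp (l * deviation r h))) ≤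
      ENNReal.ofReal (Real.exp (d * Real.log (2 * T + 1) + l ^ 2 / 2 * T)) := by
  refine (mean_potential_deviation_le p A T l 0).trans ?_
  refine (potential_le (0 + T) (c := 0) hH (fun _ _ => rfl) x₀).trans ?_
  rw [zero_add, mul_zero, Real.exp_zero, ENNReal.ofReal_one, mul_one, Real.exp_add,
    ENNReal.ofReal_mul (Real.exp_pos _).le, ← ENNReal.ofReal_pow (Real.exp_pos _).le,
    ← Real.exp_nat_mul, mul_comm (T : ℝ)]
  gcongr
  have hpos : (0 : ℝ) < 2 * T + 1 := by positivity
  rw [← Real.log_pow, Real.exp_log (by positivity)]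
  refine (Nat.cast_le.2 (growth_le (2 * T) d)).trans (le_of_eq ?_)
  rw [← ENNReal.ofReal_natCast]
  push_cast
  rfl

/-- The total loss of the best hypothesis of the class. -/
noncomputable def bestLoss (H : Set (X → Bool)) (r : List (Round X (X × Bool))) : ℝ :=
  ⨅ g : H, totalLoss r g

theorem bestLoss_nonneg (r : List (Round X (X × Bool))) : 0 ≤ bestLoss H r :=
  Real.iInf_nonneg fun _ => totalLoss_nonneg r _

theorem bestLoss_le (hH : H.Nonempty) (r : List (Round X (X × Bool))) : bestLoss H r ≤ r.length :=
  have ⟨h, hh⟩ := hH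
  (ciInf_le ⟨0, by rintro _ ⟨g, rfl⟩; exact totalLoss_nonneg r _⟩ (⟨h, hh⟩ : H)).trans
    (totalLoss_le_length r h)

theorem mean_ofReal_ne_top {f : List (Round X (X × Bool)) → ℝ} (hf : ∀ r, f r ≤ r.length) :
    mean (transcript p A T) (fun r => ENNReal.ofReal (f r)) ≠ ∞ := by
  refine ne_top_of_le_ne_top (ENNReal.natCast_ne_top T) ?_
  refine (mean_mono_support _ fun r hr => ?_).trans_eq (mean_const (transcript p A T) (T : ℝ≥0∞))
  rw [← ENNReal.ofReal_natCast]
  refine ENNReal.ofReal_le_ofReal ((hf r).trans ?_)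
  rw [length_of_mem_support p A T hr]

/-- On every transcript, the errors of exponential weights exceed the total loss of the best
hypothesis by at most the regret of exponential weights plus the largest deviation, which the
exponential dominates. -/
theorem ofReal_hedgeLoss_le {d : ℕ} {l c : ℝ} (hl : 0 < l) (hc : 0 ≤ c)
    (hne : H.Nonempty) (hH : ¬ ShattersDepth H (d + 1))
    {r : List (Round X (X × Bool))} (hr : r.length = T) :
    ENNReal.ofReal (hedgeLoss H d T l (examples r)) ≤
      ENNReal.ofReal (bestLoss H r) +
        (ENNReal.ofReal (d * Real.log (T + 1) / l + l * T / 2 + c / l) +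
        ENNReal.ofReal (Real.exp (-c) / l) *
          ⨆ h ∈ H, ENNReal.ofReal (Real.exp (l * deviation r h))) := by
  have hlog : 0 ≤ Real.log (T + 1) := Real.log_nonneg (by simp)
  set K := d * Real.log (T + 1) / l + l * T / 2 + c / l with hK
  have hK0 : 0 ≤ K := by positivity
  set S := ⨆ h ∈ H, ENNReal.ofReal (Real.exp (l * deviation r h)) with hS
  by_cases htop : S = ∞
  · rw [htop, ENNReal.mul_top (by simpa using by positivity), add_top, add_top]
    exact le_top
  rw [← ENNReal.ofReal_toReal htop, ← ENNReal.ofReal_mul (by positivity),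
    ← ENNReal.ofReal_add hK0 (by positivity),
    ← ENNReal.ofReal_add (bestLoss_nonneg r) (by positivity)]
  refine ENNReal.ofReal_le_ofReal ?_
  have : Nonempty H := hne.to_subtype
  rw [← sub_le_iff_le_add]
  refine le_ciInf fun ⟨h, hh⟩ => ?_
  have h1 := hedgeLoss_le hl hH hh (zs := examples r) (by rw [examples, List.length_map, hr])
  rw [sum_err_examples] at h1
  have h2 : Real.exp (l * deviation r h) ≤ S.toReal := by
    rw [← ENNReal.ofReal_le_iff_le_toReal htop]
    exact le_iSup₂ (f := fun h (_ : h ∈ H) => ENNReal.ofReal (Real.exp (l * deviation r h))) h hh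
  have h3 : deviation r h ≤ c / l + Real.exp (-c) / l * S.toReal := by
    have h4 : l * deviation r h ≤ c + Real.exp (-c) * S.toReal := by
      have h5 := Real.add_one_le_exp (l * deviation r h - c)
      have h6 : Real.exp (l * deviation r h - c) ≤ Real.exp (-c) * S.toReal := by
        rw [sub_eq_add_neg, add_comm, Real.exp_add]
        gcongr
      linarith
    rw [div_mul_eq_mul_div, ← add_div, le_div_iff₀ hl]
    linarith
  simp only
  linarith

/-- The regret of exponential weights over the experts, for an arbitrary learning rate. -/
theorem mean_learnerLoss_le {d : ℕ} {l : ℝ} (hl : 0 < l) (hne : H.Nonempty)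
    (hH : ¬ ShattersDepth H (d + 1)) (x₀ : X) :
    (mean (transcript (hedge H d T l) A T) fun r => ENNReal.ofReal (learnerLoss r)) ≤
      (mean (transcript (hedge H d T l) A T) fun r => ENNReal.ofReal (bestLoss H r)) +
        ENNReal.ofReal ((d * (Real.log (T + 1) + Real.log (2 * T + 1)) + 1) / l + l * T) := by
  set c := d * Real.log (2 * T + 1) + l ^ 2 / 2 * T with hc
  have hlog1 : 0 ≤ Real.log ((T : ℝ) + 1) := Real.log_nonneg (by simp)
  have hlog2 : 0 ≤ Real.log (2 * (T : ℝ) + 1) := Real.log_nonneg (by simp)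
  have hc0 : 0 ≤ c := by positivity
  rw [mean_learnerLoss_hedge]
  refine (mean_mono_support _ fun r hr => ofReal_hedgeLoss_le hl hc0 hne hH
    (length_of_mem_support _ A T hr)).trans ?_
  rw [mean_add, mean_add, mean_const, mean_mul_left]
  gcongr
  refine (add_le_add_right (mul_le_mul_right (mean_exp_deviation_le _ A l hH x₀) _) _).trans ?_
  rw [← ENNReal.ofReal_mul (by positivity), ← ENNReal.ofReal_add (by positivity) (by positivity)]
  refine ENNReal.ofReal_le_ofReal (le_of_eq ?_)
  rw [← hc, div_mul_eq_mul_div, ← Real.exp_add, neg_add_cancel, Real.exp_zero, hc]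
  field_simp
  ring

theorem regret_eq (r : List (Round X (X × Bool))) : regret H r = learnerLoss r - bestLoss H r := rfl

theorem expectation_regret_hedge_le {d : ℕ} {l : ℝ} (hl : 0 < l) (hne : H.Nonempty)
    (hH : ¬ ShattersDepth H (d + 1)) (x₀ : X) :
    Summable (fun r => (transcript (hedge H d T l) A T r).toReal * regret H r) ∧
      expectation (transcript (hedge H d T l) A T) (regret H) ≤
        (d * (Real.log (T + 1) + Real.log (2 * T + 1)) + 1) / l + l * T := by
  have ha := mean_ofReal_ne_top (T := T) (hedge H d T l) A learnerLoss_le_length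
  have hb := mean_ofReal_ne_top (T := T) (hedge H d T l) A (bestLoss_le hne)
  have hs := (hasSum_of_mean_ofReal _ learnerLoss_nonneg ha).sub
    (hasSum_of_mean_ofReal _ bestLoss_nonneg hb)
  simp only [← mul_sub, ← regret_eq] at hs
  refine ⟨hs.summable, hs.tsum_eq.trans_le ?_⟩
  have hlog1 : 0 ≤ Real.log ((T : ℝ) + 1) := Real.log_nonneg (by simp)
  have hlog2 : 0 ≤ Real.log (2 * (T : ℝ) + 1) := Real.log_nonneg (by simp)
  have h := ENNReal.toReal_mono (ENNReal.add_ne_top.2 ⟨hb, ENNReal.ofReal_ne_top⟩)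
    (mean_learnerLoss_le A hl hne hH x₀)
  rw [ENNReal.toReal_add hb ENNReal.ofReal_ne_top, ENNReal.toReal_ofReal (by positivity)] at h
  linarith

/-- A learner that always provides `f` has no regret to the class `{f}`. -/
theorem toReal_mul_regret_eq_zero (f : X → Bool) (r : List (Round X (X × Bool))) :
    (transcript (fun _ => PMF.pure f) A T r).toReal * regret {f} r = 0 := by
  by_cases hr : r ∈ (transcript (fun _ => PMF.pure f) A T).support
  · have h : learnerLoss r = totalLoss r f := by
      induction T generalizing r with
      | zero =>
        have : r ∈ (PMF.pure ([] : List (Round X (X × Bool)))).support := hr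
        rw [PMF.mem_support_pure_iff] at this
        rw [this]
        rfl
      | succ T ih =>
        rw [transcript_succ] at hr
        simp only [PMF.mem_support_bind_iff, PMF.mem_support_pure_iff] at hr
        obtain ⟨r', hr', h, rfl, z, -, rfl⟩ := hr
        have := ih r' hr'
        simp only [learnerLoss, totalLoss, List.map_cons, List.sum_cons] at this ⊢
        rw [this]
    rw [regret_eq, h, bestLoss, ciInf_unique]
    simp
  · rw [PMF.mem_support_iff, not_not] at hr
    rw [hr, ENNReal.toReal_zero, zero_mul]

/-- The learning rate `√(d log T / T)` balances the two terms of the regret. -/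
theorem rate_bound {d T : ℕ} (hd : 0 < d) (hT : 2 ≤ T) :
    (d * (Real.log (T + 1) + Real.log (2 * T + 1)) + 1) / √(d * Real.log T / T) +
      √(d * Real.log T / T) * T ≤ 8 * √(d * T * Real.log T) := by
  have hT' : (2 : ℝ) ≤ T := by exact_mod_cast hT
  have hd' : (1 : ℝ) ≤ d := by exact_mod_cast hd
  have hT0 : (0 : ℝ) < T := by linarith
  have hL : 1 / 2 < Real.log T := by
    have := Real.log_le_log two_pos hT'
    have := Real.log_two_gt_d9
    linarith
  set L := Real.log T with hLdef
  have h1 : Real.log (T + 1) ≤ 2 * L := by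
    rw [hLdef, show (2 : ℝ) * Real.log T = Real.log (T ^ 2) by rw [Real.log_pow]; norm_num]
    exact Real.log_le_log (by linarith) (by nlinarith)
  have h2 : Real.log (2 * T + 1) ≤ 3 * L := by
    rw [hLdef, show (3 : ℝ) * Real.log T = Real.log (T ^ 3) by rw [Real.log_pow]; norm_num]
    exact Real.log_le_log (by linarith) (by nlinarith [mul_self_nonneg ((T : ℝ) - 2)])
  set l := √(d * L / T) with hl
  have hl0 : 0 < l := Real.sqrt_pos.2 (by positivity)
  have hl2 : l ^ 2 = d * L / T := Real.sq_sqrt (by positivity)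
  have h3 : √(d * T * L) = l * T := by
    rw [Real.sqrt_eq_iff_mul_self_eq (by positivity) (by positivity)]
    rw [show l * T * (l * T) = l ^ 2 * T ^ 2 by ring, hl2]
    field_simp
  have h4 : (d * (Real.log (T + 1) + Real.log (2 * T + 1)) + 1) / l ≤ 7 * (l * T) := by
    rw [div_le_iff₀ hl0, show 7 * (l * T) * l = 7 * (l ^ 2 * T) by ring, hl2,
      div_mul_cancel₀ _ hT0.ne']
    have h5 : (d : ℝ) * (Real.log (T + 1) + Real.log (2 * T + 1)) ≤ d * (5 * L) := by
      gcongr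
      linarith
    nlinarith
  rw [h3]
  linarith

end game

end QuantumOnline

theorem mainTheorem2 :
    ∃ C : ℝ, 0 < C ∧
      ∀ (X : Type u) (H : Set (X → Bool)), H.Nonempty →
        ∀ d : ℕ, QuantumOnline.littlestoneDim H = (d : ℕ∞) →
          ∀ T : ℕ, 2 ≤ T →
            ∃ L : QuantumOnline.Learner X,
              ∀ A : QuantumOnline.Adversary X L.Outcome,
                Summable (fun r => (QuantumOnline.play L A T r).toReal *
                  QuantumOnline.regret H r) ∧
                QuantumOnline.expectation (QuantumOnline.play L A T) (QuantumOnline.regret H) ≤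
                  C * √((d : ℝ) * T * Real.log T) := by
  open QuantumOnline in
  refine ⟨8, by norm_num, fun X H hne d hdim T hT => ?_⟩
  have hH := not_shattersDepth_of_littlestoneDim_eq hdim
  obtain rfl | hd := Nat.eq_zero_or_pos d
  · obtain ⟨f, hf⟩ := hne
    obtain rfl : H = {f} := (subsingleton_of_not_shattersDepth_one hH).eq_singleton_of_mem hf
    refine ⟨measuringLearner fun _ => PMF.pure f, fun A => ?_⟩
    have h := toReal_mul_regret_eq_zero (T := T) A f
    refine ⟨summable_zero.congr fun r => (h r).symm, ?_⟩
    exact ((tsum_congr h).trans tsum_zero).trans_le (by simp)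
  · refine ⟨measuringLearner (hedge H d T √(d * Real.log T / T)), fun A => ?_⟩
    have hl : 0 < √(d * Real.log T / T : ℝ) := by
      have : 0 < Real.log T := Real.log_pos (by exact_mod_cast hT)
      exact Real.sqrt_pos.2 (by positivity)
    obtain ⟨z, -⟩ := (A []).support_nonempty
    have h := expectation_regret_hedge_le (T := T) A hl hne hH z.1
    exact ⟨h.1, h.2.trans (rate_bound hd hT)⟩
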